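/- Let $k=\mathbb{F}_q$ be a finite field with $q$ elements, let $D=k[t]$ and $F=k(t)$, and let $SL_2(D)$ act on the projective line $\mathbb{P}^1(F)=F\cup\{\infty\}$ by linear fractional transformations. For a subgroup $H$ of $SL_2(D)$, the cusps of $H$ are the orbits of $H$ on the $SL_2(D)$-orbit $O_\infty=\{g(\infty): g\in SL_2(D)\}$ of $\infty$. (a) If $q>3$, then $SL_2(\mathbb{F}_q[t])$ has no proper, normal subgroup of finite index with only one cusp. (b) If $q\le 3$, then for every positive integer $e$ there are uncountably many normal subgroups of index $q^e$ in $SL_2(\mathbb{F}_q[t])$ that have only one cusp. -/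

import Mathlib

open Matrix Polynomial
open scoped MatrixGroups

noncomputable section

open scoped Classical in
/-- The action of `g ∈ SL₂(D)` on the projective line `P¹(F) = F ∪ {∞}` over the quotient field `F`
of `D`, by linear fractional transformations `z ↦ (a z + b) / (c z + d)`. -/
def moebius {D F : Type*} [CommRing D] [Field F] [Algebra D F] (g : SL(2, D)) (z : OnePoint F) :
    OnePoint F :=
  SpecialLinearGroup.mapGL F g • z

/-- The `SL₂(D)`-orbit `O_∞` of the point `∞` of the projective line over `F`. -/
def orbitInfty (D F : Type*) [CommRing D] [Field F] [Algebra D F] : Set (OnePoint F) :=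
  {z | ∃ g : SL(2, D), z = moebius g OnePoint.infty}

/-- The set of `H`-cusps, for a subgroup `H` of `SL₂(D)`: the orbits of `H` on the
`SL₂(D)`-orbit `O_∞` of `∞`. -/
def cusps {D : Type*} (F : Type*) [CommRing D] [Field F] [Algebra D F] (H : Subgroup SL(2, D)) :
    Set (Set (OnePoint F)) :=
  {C | ∃ z ∈ orbitInfty D F, C = {w | ∃ h ∈ H, w = moebius h z}}

/-- The subgroup `H` of `SL₂(D)` has exactly one cusp. -/
def HasOnlyOneCusp {D : Type*} (F : Type*) [CommRing D] [Field F] [Algebra D F]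
    (H : Subgroup SL(2, D)) : Prop :=
  (cusps F H).encard = 1

end

open scoped commutatorElement

namespace SL2Elementary

section CommRing

variable {R : Type*} [CommRing R]

/-- The elementary matrix `(1 b; 0 1)`. -/
def upper (b : R) : SL(2, R) := ⟨!![1, b; 0, 1], by simp⟩

variable (R) in
/-- The Weyl element `(0 1; -1 0)`. -/
def weyl : SL(2, R) := ⟨!![0, 1; -1, 0], by simp⟩

theorem coe_upper (b : R) : (upper b : Matrix (Fin 2) (Fin 2) R) = !![1, b; 0, 1] := rfl

theorem coe_weyl : (weyl R : Matrix (Fin 2) (Fin 2) R) = !![0, 1; -1, 0] := rfl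

variable (R) in
/-- The upper triangular matrices in `SL₂(R)`. -/
def borel : Subgroup SL(2, R) where
  carrier := {g | g 1 0 = 0}
  one_mem' := by simp
  mul_mem' {a b} ha hb := by
    simp only [Set.mem_ofPred_eq] at *
    simp [Matrix.mul_apply, Fin.sum_univ_two, ha, hb]
  inv_mem' {a} ha := by
    simp only [Set.mem_ofPred_eq] at *
    simp [SpecialLinearGroup.SL2_inv_expl, ha]

theorem mem_borel {g : SL(2, R)} : g ∈ borel R ↔ g 1 0 = 0 := Iff.rfl

theorem upper_mem_borel (b : R) : upper b ∈ borel R := by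
  rw [mem_borel, coe_upper]; simp

theorem det_eq (g : SL(2, R)) : g 0 0 * g 1 1 - g 0 1 * g 1 0 = 1 := by
  rw [← Matrix.det_fin_two, g.det_coe]

/-- One step of the Euclidean algorithm on the first column of `g`, with quotient `Q`. -/
def euclidStep (Q : R) (g : SL(2, R)) : SL(2, R) := (weyl R)⁻¹ * upper (-Q) * g

theorem coe_euclidStep (Q : R) (g : SL(2, R)) :
    (euclidStep Q g : Matrix (Fin 2) (Fin 2) R) =
      !![-g 1 0, -g 1 1; g 0 0 - Q * g 1 0, g 0 1 - Q * g 1 1] := by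
  ext i j
  fin_cases i <;> fin_cases j <;>
    simp [euclidStep, coe_weyl, coe_upper, Matrix.mul_apply, Fin.sum_univ_two] <;> ring

theorem coe_upper_mul (b : R) (g : SL(2, R)) :
    ((upper b * g : SL(2, R)) : Matrix (Fin 2) (Fin 2) R) =
      !![g 0 0 + b * g 1 0, g 0 1 + b * g 1 1; g 1 0, g 1 1] := by
  ext i j
  fin_cases i <;> fin_cases j <;> simp [coe_upper, Matrix.mul_apply, Fin.sum_univ_two]

theorem coe_weyl_mul (g : SL(2, R)) :
    ((weyl R * g : SL(2, R)) : Matrix (Fin 2) (Fin 2) R) =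
      !![g 1 0, g 1 1; -g 0 0, -g 0 1] := by
  ext i j
  fin_cases i <;> fin_cases j <;> simp [coe_weyl, Matrix.mul_apply, Fin.sum_univ_two]

theorem upper_mul_weyl_mul_euclidStep (Q : R) (g : SL(2, R)) :
    upper Q * weyl R * euclidStep Q g = g := by
  ext i j
  rw [mul_assoc, coe_upper_mul, coe_weyl_mul, coe_euclidStep]
  fin_cases i <;> fin_cases j <;> simp

theorem eq_of_lower_left_eq_zero {g : SL(2, R)} (hg : g 1 0 = 0) :
    g = upper (g 0 1 * g 0 0) * (upper (g 0 0) * (weyl R * (upper (g 1 1) * ((weyl R)⁻¹ *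
      (upper (g 0 0) * (weyl R)⁻¹))))) := by
  have h := det_eq g
  rw [hg, mul_zero, sub_zero] at h
  ext i j
  rw [coe_upper_mul, coe_upper_mul, coe_weyl_mul, coe_upper_mul]
  fin_cases i <;> fin_cases j <;>
    simp [coe_upper, coe_weyl, Matrix.mul_apply, Fin.sum_univ_two, hg]
  · linear_combination (g 0 0 + g 0 0 * g 0 1) * h
  · linear_combination (-1 - g 0 1) * h
  · linear_combination h

theorem commute_of_unipotent {g h : SL(2, R)} (hg : g 1 0 = 0) (hh : h 1 0 = 0)
    (hg' : g 0 0 = 1) (hh' : h 0 0 = 1) : g * h = h * g := by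
  have h1 := det_eq g
  have h2 := det_eq h
  rw [hg, hg'] at h1
  rw [hh, hh'] at h2
  simp only [one_mul, mul_zero, sub_zero] at h1 h2
  ext i j
  fin_cases i <;> fin_cases j <;>
    simp [Matrix.mul_apply, Fin.sum_univ_two, hg, hh, hg', hh', h1, h2, add_comm]

theorem isSolvable_borel : Group.IsSolvable (borel R) := by
  let χ : borel R →* R :=
    { toFun g := (g : SL(2, R)) 0 0
      map_one' := by simp
      map_mul' a b := by
        have hb := mem_borel.1 b.2
        simp [Matrix.mul_apply, Fin.sum_univ_two, hb] }
  have : Group.IsSolvable χ.toHomUnits.ker := by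
    refine Group.isSolvable_of_comm fun a b => ?_
    have key (c : χ.toHomUnits.ker) : (c.1 : SL(2, R)) 0 0 = 1 :=
      congrArg Units.val (MonoidHom.mem_ker.1 c.2)
    exact Subtype.ext (Subtype.ext (commute_of_unipotent a.1.2 b.1.2 (key a) (key b)))
  exact Group.isSolvable_of_ker_le_range χ.toHomUnits.ker.subtype χ.toHomUnits (by simp)

theorem upper_mem_commutator (a b : Rˣ) (hab : (a : R) ^ 2 - 1 = b) (c : R) :
    upper c ∈ commutator SL(2, R) := by
  let d : SL(2, R) := ⟨!![(a : R), 0; 0, ((a⁻¹ : Rˣ) : R)], by simp⟩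
  have hd : (d : Matrix (Fin 2) (Fin 2) R) = !![(a : R), 0; 0, ((a⁻¹ : Rˣ) : R)] := rfl
  have h : d * upper (((b⁻¹ : Rˣ) : R) * c) = upper c * (upper (((b⁻¹ : Rˣ) : R) * c) * d) := by
    ext i j
    rw [coe_upper_mul, coe_upper_mul]
    fin_cases i <;> fin_cases j <;>
      simp [hd, coe_upper, Matrix.mul_apply, Fin.sum_univ_two]
    have ha : (a : R) * ((a⁻¹ : Rˣ) : R) = 1 := a.mul_inv
    have hb : (b : R) * ((b⁻¹ : Rˣ) : R) = 1 := b.mul_inv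
    rw [← hab] at hb
    linear_combination (((a⁻¹ : Rˣ) : R) * c) * hb - (a * ((b⁻¹ : Rˣ) : R) * c) * ha
  have h' : upper c = ⁅d, upper (((b⁻¹ : Rˣ) : R) * c)⁆ := by
    rw [commutatorElement_def, h]
    group
  rw [h']
  exact Subgroup.commutator_mem_commutator (Subgroup.mem_top _) (Subgroup.mem_top _)

theorem weyl_eq : weyl R = upper 1 * (weyl R * upper 1 * (weyl R)⁻¹) * upper 1 := by
  ext i j
  simp only [mul_assoc]
  rw [coe_upper_mul, coe_weyl_mul, coe_upper_mul]
  fin_cases i <;> fin_cases j <;>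
    simp [coe_upper, coe_weyl, Matrix.mul_apply, Fin.sum_univ_two]

end CommRing

section Polynomial

variable {k : Type*} [Field k]

theorem degree_euclidStep_div {g : SL(2, k[X])} (hg : g 1 0 ≠ 0) :
    (euclidStep (g 0 0 / g 1 0) g 1 0).degree < (g 1 0).degree := by
  have h : euclidStep (g 0 0 / g 1 0) g 1 0 = g 0 0 % g 1 0 := by
    rw [coe_euclidStep]
    simp only [Matrix.of_apply, Matrix.cons_val_one, Matrix.cons_val_zero, Matrix.cons_val',
      Matrix.cons_val_fin_one]
    linear_combination - EuclideanDomain.div_add_mod (g 0 0) (g 1 0)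
  rw [h]
  exact degree_mod_lt _ hg

theorem eq_top_of_upper_weyl_mem {K : Subgroup SL(2, k[X])} (hu : ∀ b, upper b ∈ K)
    (hw : weyl k[X] ∈ K) : K = ⊤ := by
  suffices h : ∀ (d : WithBot ℕ) (g : SL(2, k[X])), (g 1 0).degree = d → g ∈ K from
    (Subgroup.eq_top_iff' K).2 fun g => h _ g rfl
  intro d
  induction d using WellFoundedLT.induction with
  | ind d ih =>
    rintro g rfl
    by_cases hg : g 1 0 = 0
    · rw [eq_of_lower_left_eq_zero hg]
      have hw' := K.inv_mem hw
      exact K.mul_mem (hu _) (K.mul_mem (hu _) (K.mul_mem hw (K.mul_mem (hu _)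
        (K.mul_mem hw' (K.mul_mem (hu _) hw')))))
    · rw [← upper_mul_weyl_mul_euclidStep (g 0 0 / g 1 0) g]
      exact K.mul_mem (K.mul_mem (hu _) hw) (ih _ (degree_euclidStep_div hg) _ rfl)

theorem commutator_eq_top [Finite k] (hk : 3 < Nat.card k) : commutator SL(2, k[X]) = ⊤ := by
  classical
  have := Fintype.ofFinite k
  obtain ⟨a, ha⟩ : ∃ a : k, a ∉ ({0, 1, -1} : Finset k) := by
    by_contra! h
    have h1 : (Finset.univ : Finset k) ⊆ {0, 1, -1} := fun x _ => h x
    have h2 := Finset.card_le_card h1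
    rw [Finset.card_univ, ← Nat.card_eq_fintype_card] at h2
    have := Finset.card_le_three (a := (0 : k)) (b := 1) (c := -1)
    omega
  simp only [Finset.mem_insert, Finset.mem_singleton, not_or] at ha
  have hb : a ^ 2 - 1 ≠ 0 := by
    rw [show a ^ 2 - 1 = (a - 1) * (a + 1) by ring]
    exact mul_ne_zero (sub_ne_zero.2 ha.2.1) (fun h => ha.2.2 (eq_neg_of_add_eq_zero_left h))
  have hu : ∀ c : k[X], upper c ∈ commutator SL(2, k[X]) :=
    upper_mem_commutator (Units.map (C : k →+* k[X]).toMonoidHom (Units.mk0 a ha.1))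
      (Units.map (C : k →+* k[X]).toMonoidHom (Units.mk0 _ hb)) (by simp)
  refine eq_top_of_upper_weyl_mem hu ?_
  rw [weyl_eq]
  exact Subgroup.mul_mem _ (Subgroup.mul_mem _ (hu 1)
    (Subgroup.Normal.conj_mem inferInstance _ (hu 1) _)) (hu 1)

theorem eq_top_of_mul_borel [Finite k] (hk : 3 < Nat.card k) (N : Subgroup SL(2, k[X]))
    [N.Normal] (hN : ∀ g, ∃ h ∈ N, h⁻¹ * g ∈ borel k[X]) : N = ⊤ := by
  have := isSolvable_borel (R := k[X])
  have hsurj : Function.Surjective ((QuotientGroup.mk' N).comp (borel k[X]).subtype) := by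
    intro x
    obtain ⟨g, rfl⟩ := QuotientGroup.mk'_surjective N x
    obtain ⟨h, hh, hb⟩ := hN g
    refine ⟨⟨_, hb⟩, ?_⟩
    simpa using hh
  have : Group.IsSolvable (SL(2, k[X]) ⧸ N) := Group.isSolvable_of_surjective hsurj
  by_contra hne
  have : Nontrivial (SL(2, k[X]) ⧸ N) := QuotientGroup.nontrivial_iff.2 hne
  refine (Group.IsSolvable.commutator_lt_top_of_nontrivial (SL(2, k[X]) ⧸ N)).ne ?_
  have h := Subgroup.map_commutator ⊤ ⊤ (QuotientGroup.mk' N)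
  rw [← commutator_def, commutator_eq_top hk, ← MonoidHom.range_eq_map,
    MonoidHom.range_eq_top.2 (QuotientGroup.mk'_surjective N)] at h
  rw [commutator_def, ← h]

end Polynomial

end SL2Elementary

namespace SL2Elementary

section Retraction

variable {k : Type*} [Field k]

open scoped Classical in
/-- A function on `SL₂(k[t])`, defined by the Euclidean algorithm on the first column, which sends
`upper b` to `b`. It is a homomorphism to the additive group of `k[t]` if `k` has at most three
elements. -/
noncomputable def retraction (g : SL(2, k[X])) : k[X] :=
  if _h : g 1 0 = 0 then g 0 0 * g 0 1
  else g 0 0 / g 1 0 - 3 + retraction (euclidStep (g 0 0 / g 1 0) g)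
termination_by (g 1 0).degree
decreasing_by exact degree_euclidStep_div _h

theorem retraction_of_eq_zero {g : SL(2, k[X])} (hg : g 1 0 = 0) :
    retraction g = g 0 0 * g 0 1 := by
  rw [retraction, dif_pos hg]

theorem retraction_of_ne_zero {g : SL(2, k[X])} (hg : g 1 0 ≠ 0) :
    retraction g = g 0 0 / g 1 0 - 3 + retraction (euclidStep (g 0 0 / g 1 0) g) := by
  rw [retraction, dif_neg hg]

theorem eq_div_of_degree_sub_lt {a c Q : k[X]} (h : (a - Q * c).degree < c.degree) :
    Q = a / c := by
  have hc : c ≠ 0 := by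
    rintro rfl
    simp at h
  by_contra hne
  have h1 : (a % c - (a - Q * c)).degree < c.degree :=
    (degree_sub_le _ _).trans_lt (max_lt (degree_mod_lt a hc) h)
  have h2 : a % c - (a - Q * c) = (Q - a / c) * c := by
    linear_combination EuclideanDomain.div_add_mod a c
  rw [h2, degree_mul] at h1
  have h3 : (0 : WithBot ℕ) ≤ (Q - a / c).degree := zero_le_degree_iff.2 (sub_ne_zero.2 hne)
  exact absurd h1 (not_lt.2 (le_add_of_nonneg_left h3))

theorem retraction_of_degree_lt {g : SL(2, k[X])} {Q : k[X]}
    (h : (g 0 0 - Q * g 1 0).degree < (g 1 0).degree) :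
    retraction g = Q - 3 + retraction (euclidStep Q g) := by
  have hg : g 1 0 ≠ 0 := by
    intro hg
    simp [hg] at h
  rw [retraction_of_ne_zero hg, ← eq_div_of_degree_sub_lt h]

theorem degree_sub_div_mul_lt {a c : k[X]} (hc : c ≠ 0) : (a - a / c * c).degree < c.degree := by
  have h : a - a / c * c = a % c := by
    linear_combination - EuclideanDomain.div_add_mod a c
  rw [h]
  exact degree_mod_lt a hc

theorem retraction_neg (g : SL(2, k[X])) : retraction (-g) = retraction g := by
  induction hd : (g 1 0).degree using WellFoundedLT.induction generalizing g with
  | ind d ih =>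
    subst hd
    by_cases hg : g 1 0 = 0
    · rw [retraction_of_eq_zero hg, retraction_of_eq_zero (by simp [hg])]
      simp
    · have h := degree_sub_div_mul_lt (a := g 0 0) hg
      have h' : ((-g : SL(2, k[X])) 0 0 - g 0 0 / g 1 0 * (-g : SL(2, k[X])) 1 0).degree <
          ((-g : SL(2, k[X])) 1 0).degree := by
        have h00 : (-g : SL(2, k[X])) 0 0 = -g 0 0 := by simp
        have h10 : (-g : SL(2, k[X])) 1 0 = -g 1 0 := by simp
        rw [h00, h10, degree_neg, mul_neg, sub_neg_eq_add, neg_add_eq_sub, ← neg_sub, degree_neg]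
        exact h
      have h2 : euclidStep (g 0 0 / g 1 0) (-g) = -euclidStep (g 0 0 / g 1 0) g := by
        simp [euclidStep]
      rw [retraction_of_degree_lt h, retraction_of_degree_lt h', h2,
        ih _ (degree_euclidStep_div hg) _ rfl]

theorem retraction_upper_mul (b : k[X]) (g : SL(2, k[X])) :
    retraction (upper b * g) = b + retraction g := by
  have h00 : (upper b * g) 0 0 = g 0 0 + b * g 1 0 := by rw [coe_upper_mul]; simp
  have h01 : (upper b * g) 0 1 = g 0 1 + b * g 1 1 := by rw [coe_upper_mul]; simp
  have h10 : (upper b * g) 1 0 = g 1 0 := by rw [coe_upper_mul]; simp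
  by_cases hg : g 1 0 = 0
  · rw [retraction_of_eq_zero hg, retraction_of_eq_zero (h10.trans hg), h00, h01, hg]
    have h := det_eq g
    rw [hg] at h
    linear_combination b * h
  · have h := degree_sub_div_mul_lt (a := g 0 0) hg
    have h' : ((upper b * g) 0 0 - (g 0 0 / g 1 0 + b) * (upper b * g) 1 0).degree <
        ((upper b * g) 1 0).degree := by
      rw [h00, h10]
      convert h using 2
      ring
    have h2 : euclidStep (g 0 0 / g 1 0 + b) (upper b * g) = euclidStep (g 0 0 / g 1 0) g := by
      ext i j : 1
      rw [coe_euclidStep, coe_euclidStep, coe_upper_mul]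
      fin_cases i <;> fin_cases j <;> simp <;> ring
    rw [retraction_of_degree_lt h, retraction_of_degree_lt h', h2]
    ring

theorem retraction_weyl_mul_of_degree_eq {g : SL(2, k[X])} {ε : k[X]} (hε : ε = 1 ∨ ε = -1)
    (h6 : (6 : k[X]) = 0) (hd : (g 0 0).degree = (g 1 0).degree)
    (h : (g 0 0 - ε * g 1 0).degree < (g 1 0).degree) :
    retraction (weyl k[X] * g) = retraction g - 3 := by
  have h00 : (weyl k[X] * g) 0 0 = g 1 0 := by rw [coe_weyl_mul]; simp
  have h10 : (weyl k[X] * g) 1 0 = -g 0 0 := by rw [coe_weyl_mul]; simp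
  have h' : ((weyl k[X] * g) 0 0 - (-ε) * (weyl k[X] * g) 1 0).degree <
      ((weyl k[X] * g) 1 0).degree := by
    rw [h00, h10, degree_neg, hd]
    convert h using 1
    rcases hε with rfl | rfl
    · rw [← degree_neg]
      congr 1
      ring
    · congr 1
      ring
  rw [retraction_of_degree_lt h, retraction_of_degree_lt h']
  rcases hε with rfl | rfl
  · have h2 : euclidStep (-1) (weyl k[X] * g) = upper (-1) * -euclidStep 1 g := by
      ext i j : 1
      rw [coe_euclidStep, coe_upper_mul, coe_weyl_mul, SpecialLinearGroup.coe_neg, coe_euclidStep]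
      fin_cases i <;> fin_cases j <;> simp
    rw [h2, retraction_upper_mul, retraction_neg]
    ring
  · have h2 : euclidStep (- -1) (weyl k[X] * g) = upper 1 * euclidStep (-1) g := by
      ext i j : 1
      rw [coe_euclidStep, coe_upper_mul, coe_weyl_mul, coe_euclidStep]
      fin_cases i <;> fin_cases j <;> simp <;> ring
    rw [h2, retraction_upper_mul]
    linear_combination h6

theorem retraction_weyl_mul (hk : ∀ x : k, x = 0 ∨ x = 1 ∨ x = -1) (h6 : (6 : k[X]) = 0)
    (g : SL(2, k[X])) : retraction (weyl k[X] * g) = retraction g - 3 := by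
  rcases lt_trichotomy (g 0 0).degree (g 1 0).degree with hd | hd | hd
  · have h : (g 0 0 - 0 * g 1 0).degree < (g 1 0).degree := by simpa using hd
    have h2 : euclidStep 0 g = -(weyl k[X] * g) := by
      ext i j : 1
      rw [coe_euclidStep, SpecialLinearGroup.coe_neg, coe_weyl_mul]
      fin_cases i <;> fin_cases j <;> simp
    rw [retraction_of_degree_lt h, h2, retraction_neg]
    linear_combination h6
  · have hc : g 1 0 ≠ 0 := by
      intro hc
      have ha : g 0 0 = 0 := by rwa [hc, degree_zero, degree_eq_bot] at hd
      have h := det_eq g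
      simp [hc, ha] at h
    have ha : g 0 0 ≠ 0 := by
      intro ha
      rw [ha, degree_zero, eq_comm, degree_eq_bot] at hd
      exact hc hd
    have hlc := leadingCoeff_ne_zero.2 hc
    have key (e : k) (he : e ≠ 0) (h : (g 0 0).leadingCoeff / (g 1 0).leadingCoeff = e) :
        (g 0 0 - C e * g 1 0).degree < (g 1 0).degree := by
      rw [← hd]
      refine degree_sub_lt_left ?_ ha ?_
      · rw [degree_C_mul he, hd]
      · rw [leadingCoeff_mul, leadingCoeff_C, ← h, div_mul_cancel₀ _ hlc]
    rcases hk ((g 0 0).leadingCoeff / (g 1 0).leadingCoeff) with h | h | h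
    · exact absurd h (div_ne_zero (leadingCoeff_ne_zero.2 ha) hlc)
    · exact retraction_weyl_mul_of_degree_eq (Or.inl rfl) h6 hd (by simpa using key 1 (by simp) h)
    · exact retraction_weyl_mul_of_degree_eq (Or.inr rfl) h6 hd
        (by simpa using key (-1) (by simp) h)
  · have h00 : (weyl k[X] * g) 0 0 = g 1 0 := by rw [coe_weyl_mul]; simp
    have h10 : (weyl k[X] * g) 1 0 = -g 0 0 := by rw [coe_weyl_mul]; simp
    have h : ((weyl k[X] * g) 0 0 - 0 * (weyl k[X] * g) 1 0).degree <
        ((weyl k[X] * g) 1 0).degree := by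
      rw [h00, h10, zero_mul, sub_zero, degree_neg]
      exact hd
    have h2 : euclidStep 0 (weyl k[X] * g) = g := by
      have h0 : upper (0 : k[X]) = 1 := Subtype.ext (by simp [coe_upper, Matrix.one_fin_two])
      simp [euclidStep, h0]
    rw [retraction_of_degree_lt h, h2]
    ring

theorem retraction_upper (b : k[X]) : retraction (upper b) = b := by
  rw [retraction_of_eq_zero] <;> simp [coe_upper]

theorem retraction_mul (hk : ∀ x : k, x = 0 ∨ x = 1 ∨ x = -1) (h6 : (6 : k[X]) = 0)
    (g h : SL(2, k[X])) : retraction (g * h) = retraction g + retraction h := by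
  have h1 : retraction (1 : SL(2, k[X])) = 0 := by
    rw [retraction_of_eq_zero] <;> simp
  let K : Subgroup SL(2, k[X]) :=
    { carrier := {g | ∀ h, retraction (g * h) = retraction g + retraction h}
      one_mem' := by simp [h1]
      mul_mem' {a b} ha hb h := by
        rw [mul_assoc, ha, hb, ha b, add_assoc]
      inv_mem' {a} ha h := by
        have e1 := ha a⁻¹
        have e2 := ha (a⁻¹ * h)
        rw [mul_inv_cancel, h1] at e1
        rw [mul_inv_cancel_left] at e2
        linear_combination e1 - e2 }
  have hK : K = ⊤ := by
    refine eq_top_of_upper_weyl_mem (fun b h => ?_) (fun h => ?_)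
    · rw [retraction_upper_mul, retraction_upper]
    · have hw := retraction_weyl_mul hk h6 1
      rw [mul_one, h1] at hw
      rw [retraction_weyl_mul hk h6, hw]
      ring
  have hg : g ∈ K := hK ▸ Subgroup.mem_top g
  exact hg h

/-- If every element of `k` is `0` or `±1`, then `retraction` is a homomorphism. -/
noncomputable def retractionHom (hk : ∀ x : k, x = 0 ∨ x = 1 ∨ x = -1) (h6 : (6 : k[X]) = 0) :
    SL(2, k[X]) →* Multiplicative k[X] :=
  MonoidHom.mk' (fun g => Multiplicative.ofAdd (retraction g)) fun g h => by
    rw [retraction_mul hk h6, ofAdd_add]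

end Retraction

section Small

variable {k : Type*} [Field k]

theorem eq_zero_or_one_or_neg_one [Finite k] (hk : Nat.card k ≤ 3) (x : k) :
    x = 0 ∨ x = 1 ∨ x = -1 := by
  classical
  have := Fintype.ofFinite k
  have hle (a b c d : k) (hab : a ≠ b) (hac : a ≠ c) (had : a ≠ d) (hbc : b ≠ c) (hbd : b ≠ d)
      (hcd : c ≠ d) : False := by
    have h := Finset.card_le_univ ({a, b, c, d} : Finset k)
    rw [Finset.card_insert_of_notMem (by simp [*]), Finset.card_insert_of_notMem (by simp [*]),
      Finset.card_pair hcd, ← Nat.card_eq_fintype_card] at h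
    omega
  by_contra! h
  obtain ⟨h0, h1, h2⟩ := h
  by_cases h3 : (1 : k) = -1
  · refine hle 0 1 x (x + 1) zero_ne_one h0.symm ?_ h1.symm ?_ ?_
    · exact fun h => h2 (eq_neg_of_add_eq_zero_left h.symm)
    · exact fun h => h0 (by simpa using h)
    · simp
  · exact hle 0 1 (-1) x zero_ne_one (by simp) h0.symm h3 h1.symm h2.symm

theorem six_eq_zero (hk : ∀ x : k, x = 0 ∨ x = 1 ∨ x = -1) : (6 : k[X]) = 0 := by
  have h : (6 : k) = 0 := by
    rcases hk 2 with h | h | h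
    · linear_combination 3 * h
    · exact absurd (by linear_combination h) (one_ne_zero (α := k))
    · linear_combination 2 * h
  rw [show (6 : k[X]) = C (6 : k) from rfl, h, C_0]

end Small

end SL2Elementary

namespace SL2Elementary

section Cusps

variable {D F : Type*} [CommRing D] [Field F] [Algebra D F]

theorem moebius_mul (g h : SL(2, D)) (z : OnePoint F) :
    moebius (g * h) z = moebius g (moebius h z) := by
  simp [moebius, mul_smul]

theorem moebius_one (z : OnePoint F) : moebius (1 : SL(2, D)) z = z := by
  simp [moebius]

theorem moebius_infty_eq_infty_iff [FaithfulSMul D F] {g : SL(2, D)} :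
    moebius g (OnePoint.infty : OnePoint F) = OnePoint.infty ↔ g ∈ borel D := by
  classical
  rw [moebius, OnePoint.smul_infty_eq_self_iff, mem_borel]
  simp

/-- A subgroup has only one cusp if and only if it acts transitively on the orbit of `∞`. -/
theorem hasOnlyOneCusp_iff [FaithfulSMul D F] {H : Subgroup SL(2, D)} :
    HasOnlyOneCusp F H ↔ ∀ g, ∃ h ∈ H, h⁻¹ * g ∈ borel D := by
  let cusp (z : OnePoint F) : Set (OnePoint F) := {w | ∃ h ∈ H, w = moebius h z}
  have hinf : (OnePoint.infty : OnePoint F) ∈ orbitInfty D F := ⟨1, (moebius_one _).symm⟩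
  constructor
  · intro hH g
    obtain ⟨S, hS⟩ := Set.encard_eq_one.1 hH
    have hcusp (z : OnePoint F) (hz : z ∈ orbitInfty D F) : cusp z = S := by
      have h : cusp z ∈ cusps F H := ⟨z, hz, rfl⟩
      rw [hS] at h
      exact h
    have hg : moebius g OnePoint.infty ∈ cusp (OnePoint.infty : OnePoint F) := by
      rw [hcusp _ hinf, ← hcusp _ ⟨g, rfl⟩]
      exact ⟨1, H.one_mem, (moebius_one _).symm⟩
    obtain ⟨h, hh, hgh⟩ := hg
    refine ⟨h, hh, (moebius_infty_eq_infty_iff (F := F)).1 ?_⟩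
    rw [moebius_mul, hgh, ← moebius_mul, inv_mul_cancel, moebius_one]
  · intro hH
    refine Set.encard_eq_one.2 ⟨cusp OnePoint.infty, Set.eq_singleton_iff_unique_mem.2
      ⟨⟨_, hinf, rfl⟩, ?_⟩⟩
    rintro _ ⟨_, ⟨g, rfl⟩, rfl⟩
    obtain ⟨h, hh, hb⟩ := hH g
    have hg : moebius g (OnePoint.infty : OnePoint F) = moebius h OnePoint.infty := by
      conv_lhs => rw [← mul_inv_cancel_left h g, moebius_mul, moebius_infty_eq_infty_iff.2 hb]
    rw [hg]
    ext w
    constructor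
    · rintro ⟨x, hx, rfl⟩
      exact ⟨x * h, H.mul_mem hx hh, (moebius_mul _ _ _).symm⟩
    · rintro ⟨x, hx, rfl⟩
      refine ⟨x * h⁻¹, H.mul_mem hx (H.inv_mem hh), ?_⟩
      rw [← moebius_mul, inv_mul_cancel_right]

end Cusps

section Kernels

variable {k : Type*} [Field k]

/-- A linear map from `k[t]` onto `k ^ e` whose kernel determines the set `S`. -/
noncomputable def coordMap (k : Type*) [Field k] (e : ℕ) (S : Set ℕ) :
    k[X] →ₗ[k] (Fin e → k) :=
  (basisMonomials k).constr k fun n =>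
    if h : n < e then Pi.single ⟨n, h⟩ 1 else S.indicator 1 (n - e)

theorem coordMap_X_pow (e : ℕ) (S : Set ℕ) (n : ℕ) :
    coordMap k e S (X ^ n) =
      if h : n < e then Pi.single ⟨n, h⟩ 1 else S.indicator 1 (n - e) := by
  rw [X_pow_eq_monomial, ← congrFun (coe_basisMonomials k) n, coordMap, Module.Basis.constr_basis]

theorem coordMap_surjective (e : ℕ) (S : Set ℕ) : Function.Surjective (coordMap k e S) := by
  rw [← LinearMap.range_eq_top, eq_top_iff, ← (Pi.basisFun k (Fin e)).span_eq, Submodule.span_le]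
  rintro _ ⟨i, rfl⟩
  refine ⟨X ^ (i : ℕ), ?_⟩
  rw [coordMap_X_pow, dif_pos i.2, Pi.basisFun_apply]

theorem coordMap_X_pow_add_eq_zero_iff {e : ℕ} (he : 1 ≤ e) (S : Set ℕ) (n : ℕ) :
    coordMap k e S (X ^ (e + n)) = 0 ↔ n ∉ S := by
  have : Nonempty (Fin e) := ⟨⟨0, he⟩⟩
  rw [coordMap_X_pow, dif_neg (by omega), Nat.add_sub_cancel_left]
  by_cases hn : n ∈ S <;> simp [hn]

variable (hk : ∀ x : k, x = 0 ∨ x = 1 ∨ x = -1)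

/-- The homomorphism from `SL₂(k[t])` onto `k ^ e` which sends `upper b` to `coordMap k e S b`. -/
noncomputable def coordHom (e : ℕ) (S : Set ℕ) : SL(2, k[X]) →* Multiplicative (Fin e → k) :=
  (coordMap k e S).toAddMonoidHom.toMultiplicative.comp (retractionHom hk (six_eq_zero hk))

theorem coordHom_upper (e : ℕ) (S : Set ℕ) (b : k[X]) :
    coordHom hk e S (upper b) = Multiplicative.ofAdd (coordMap k e S b) := by
  have h : retractionHom hk (six_eq_zero hk) (upper b) = Multiplicative.ofAdd b :=
    congrArg Multiplicative.ofAdd (retraction_upper b)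
  rw [coordHom, MonoidHom.comp_apply, h]
  rfl

theorem exists_coordHom_upper (e : ℕ) (S : Set ℕ) (x : Multiplicative (Fin e → k)) :
    ∃ b, coordHom hk e S (upper b) = x := by
  obtain ⟨b, hb⟩ := coordMap_surjective (k := k) e S x.toAdd
  exact ⟨b, by rw [coordHom_upper, hb, ofAdd_toAdd]⟩

theorem index_ker_coordHom [Finite k] (e : ℕ) (S : Set ℕ) :
    (coordHom hk e S).ker.index = Nat.card k ^ e := by
  have h : Function.Surjective (coordHom hk e S) := fun x =>
    let ⟨b, hb⟩ := exists_coordHom_upper hk e S x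
    ⟨upper b, hb⟩
  rw [Subgroup.index_ker, MonoidHom.range_eq_top.2 h, Subgroup.card_top,
    Nat.card_congr Multiplicative.toAdd, Nat.card_fun, Nat.card_fin]

theorem hasOnlyOneCusp_ker_coordHom (F : Type*) [Field F] [Algebra k[X] F] [FaithfulSMul k[X] F]
    (e : ℕ) (S : Set ℕ) : HasOnlyOneCusp F (coordHom hk e S).ker := by
  refine hasOnlyOneCusp_iff.2 fun g => ?_
  obtain ⟨b, hb⟩ := exists_coordHom_upper hk e S (coordHom hk e S g)
  refine ⟨g * (upper b)⁻¹, ?_, ?_⟩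
  · rw [MonoidHom.mem_ker, map_mul, map_inv, hb, mul_inv_cancel]
  · rw [_root_.mul_inv_rev, inv_inv, inv_mul_cancel_right]
    exact upper_mem_borel b

theorem ker_coordHom_injective {e : ℕ} (he : 1 ≤ e) :
    Function.Injective fun S => (coordHom hk e S).ker := by
  have key (S : Set ℕ) (n : ℕ) : upper (X ^ (e + n)) ∈ (coordHom hk e S).ker ↔ n ∉ S := by
    rw [MonoidHom.mem_ker, coordHom_upper, ofAdd_eq_one, coordMap_X_pow_add_eq_zero_iff he]
  intro S T hST
  ext n
  have hST' : (coordHom hk e S).ker = (coordHom hk e T).ker := hST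
  rw [← not_iff_not, ← key S, ← key T, hST']

end Kernels

end SL2Elementary

open SL2Elementary in
theorem proposition3p3 (k : Type*) [Field k] [Finite k] :
    (3 < Nat.card k →
      ¬ ∃ N : Subgroup SL(2, k[X]),
        N ≠ ⊤ ∧ N.Normal ∧ N.FiniteIndex ∧ HasOnlyOneCusp (RatFunc k) N) ∧
    (Nat.card k ≤ 3 → ∀ e : ℕ, 1 ≤ e →
      ¬ {N : Subgroup SL(2, k[X]) |
        N.Normal ∧ N.index = Nat.card k ^ e ∧ HasOnlyOneCusp (RatFunc k) N}.Countable) := by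
  constructor
  · rintro hk ⟨N, hN, hnormal, -, hcusp⟩
    exact hN (eq_top_of_mul_borel hk N (hasOnlyOneCusp_iff.1 hcusp))
  · intro hk e he hcount
    have hk' := eq_zero_or_one_or_neg_one hk
    let f : Set ℕ → {N : Subgroup SL(2, k[X]) |
        N.Normal ∧ N.index = Nat.card k ^ e ∧ HasOnlyOneCusp (RatFunc k) N} := fun S =>
      ⟨(coordHom hk' e S).ker, inferInstance, index_ker_coordHom hk' e S,
        hasOnlyOneCusp_ker_coordHom hk' _ e S⟩
    have hf : Function.Injective f := fun S T h =>
      ker_coordHom_injective hk' he (congrArg Subtype.val h)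
    have := hcount.to_subtype
    have := hf.countable
    obtain ⟨F, hF⟩ := exists_surjective_nat (Set ℕ)
    exact Function.cantor_surjective F hF
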